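/- Let $L$ be a set of labels, $V$ the complex vector space with basis $\{\phi(x):x\in L\}$, and $\mathsf S(V)$ its symmetric algebra, with the coproduct $\Delta$ that is the algebra map with $\Delta\phi(x)=\phi(x)\otimes\mathbf 1+\mathbf 1\otimes\phi(x)$. Let $K:L\times L\to\mathbb C$ be symmetric (the kernel $G_F^{-1}$ of the inverse propagator). In the completion of $\mathsf S(V)^{\otimes k}$ that consists of arbitrary formal linear combinations of monomials, put, for $1\le i<j\le k$, $R_{i,j}=\sum_{x,y\in L}K(x,y)\,\phi(x)_i\,\phi(y)_j$, where $\phi(x)_i$ is $\phi(x)$ in the $i$-th tensor factor. Let $\Delta_i$ be the coproduct applied to the $i$-th of $k$ tensor factors (which becomes the factors $i$ and $i+1$), put $Q_i=\tfrac12R_{i,i+1}\cdot\Delta_i$, and define $\Lambda^0=\mathrm{id}$ and $\Lambda^k=\frac1k\sum_{i=1}^kQ_i\circ\Lambda^{k-1}$ for $k\ge1$. An ordered graph with vertices $1,\dots,k$ and $n$ distinguishable external legs (loopless, multiple internal edges allowed), the $a$-th leg being labelled by $x_a$ and attached to the vertex $v(a)$, corresponds to the element $\prod_{e}R_{i_e,j_e}\cdot\prod_{a=1}^n\phi(x_a)_{v(a)}$,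 where $e$ runs over the internal edges and $i_e<j_e$ are the ends of $e$. Two ordered graphs have the same underlying unordered graph if they differ by a permutation of the vertices. **Lemma.** Let $k\ge1$ and $n\ge0$. There is exactly one finite linear combination of ordered graphs with $k$ vertices and $n$ external legs, with complex coefficients (the weights of the ordered graphs) that do not depend on $L$, $K$ and $x_1,\dots,x_n$, such that for all $L$, all symmetric $K$ and all labels $x_1,\dots,x_n\in L$ the element $\Lambda^{k-1}(\phi(x_1)\cdots\phi(x_n))$ is the corresponding linear combination of the elements of these graphs. Let $\gamma$ be a tree with $k$ vertices and external legs labelled by $x_1,\dots,x_n$. Then the weight of $\gamma$, that is, the sum of the weights of all ordered graphs whose underlying unordered graph is $\gamma$, is $1/s$, where $s$ is the symmetry factor of $\gamma$: the number of permutations of the vertices of $\gamma$ that fix its internal edges and its external legs. -/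

import Mathlib

universe u

noncomputable section

namespace TreeWeight

/-! ### The field operator algebra and its completed tensor powers -/

/-- The space `V` of finite linear combinations of the elementary fields `φ(x)`, `x : L`. -/
abbrev FieldSpace (L : Type u) : Type u := L →₀ ℂ

/-- The algebra `S(V)`; its coproduct is Mathlib's coproduct on the symmetric algebra. -/
abbrev FieldAlgebra (L : Type u) : Type u := SymmetricAlgebra ℂ (FieldSpace L)

/-- The elementary field `φ(x)` in `S(V)`. -/
def field {L : Type u} (x : L) : FieldAlgebra L :=
  SymmetricAlgebra.ι ℂ (FieldSpace L) (Finsupp.single x 1)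

/-- The completion of `S(V)^{⊗ k}`: arbitrary formal (possibly infinite) linear combinations of the
monomials in the variables `X (i, x)`, where `X (i, x)` is the field `φ(x)` in the tensor factor
number `i`. -/
abbrev CompletedPower (k : ℕ) (L : Type u) : Type u := MvPowerSeries (Fin k × L) ℂ

/-- The inclusion `a ↦ 1 ⊗ ⋯ ⊗ a ⊗ ⋯ ⊗ 1` of `S(V)` as the tensor factor number `i`. -/
def factor {k : ℕ} {L : Type u} (i : Fin k) : FieldAlgebra L →ₐ[ℂ] CompletedPower k L :=
  SymmetricAlgebra.lift
    (Finsupp.linearCombination ℂ (fun x : L => (MvPowerSeries.X (i, x) : CompletedPower k L)))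

theorem factor_field {k : ℕ} {L : Type u} (i : Fin k) (x : L) :
    factor i (field x) = (MvPowerSeries.X (i, x) : CompletedPower k L) := by
  simp [factor, field]

/-- The image of the field `φ(x)` in the tensor factor number `j` under the coproduct of the
tensor factor number `i`. The factor `i` becomes the factors `i` and `i + 1`, and the factors after
`i` are renumbered. -/
def splitVariable {k : ℕ} {L : Type u} (i : Fin k) (p : Fin k × L) : CompletedPower (k + 1) L :=
  if p.1 < i then MvPowerSeries.X (p.1.castSucc, p.2)
  else if p.1 = i then MvPowerSeries.X (p.1.castSucc, p.2) + MvPowerSeries.X (p.1.succ, p.2)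
  else MvPowerSeries.X (p.1.succ, p.2)

theorem hasSubst_splitVariable {k : ℕ} {L : Type u} (i : Fin k) :
    MvPowerSeries.HasSubst (splitVariable (L := L) i) := by
  classical
  refine ⟨fun p => ?_, fun d => ?_⟩
  · unfold splitVariable
    split_ifs <;> simp
  · refine Set.Finite.subset ((Set.finite_univ (α := Fin k)).prod
      (d.support.image Prod.snd).finite_toSet) fun p hp => ⟨trivial, ?_⟩
    have key : ∀ q : Fin (k + 1), MvPowerSeries.coeff d
        (MvPowerSeries.X (q, p.2) : CompletedPower (k + 1) L) ≠ 0 →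
        p.2 ∈ d.support.image Prod.snd := by
      intro q hq
      rw [MvPowerSeries.coeff_X] at hq
      have hd : d = Finsupp.single (q, p.2) 1 := by
        by_contra h
        exact hq (if_neg h)
      exact Finset.mem_image.2 ⟨(q, p.2), by simp [hd], rfl⟩
    simp only [Set.mem_ofPred_eq, splitVariable] at hp
    simp only [Finset.mem_coe]
    split_ifs at hp with h1 h2
    · exact key _ hp
    · by_cases h3 : MvPowerSeries.coeff d
          (MvPowerSeries.X (p.1.castSucc, p.2) : CompletedPower (k + 1) L) = 0
      · refine key p.1.succ fun h4 => hp ?_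
        rw [map_add, h3, h4, add_zero]
      · exact key _ h3
    · exact key _ hp

/-- The coproduct `Δ_i = id ⊗ ⋯ ⊗ Δ ⊗ ⋯ ⊗ id` on the tensor factor number `i`, extended to the
completions. -/
def coproductAt {k : ℕ} {L : Type u} (i : Fin k) :
    CompletedPower k L →ₐ[ℂ] CompletedPower (k + 1) L :=
  MvPowerSeries.substAlgHom (hasSubst_splitVariable i)

/-- On the tensor factor `i`, the map `coproductAt i` is the coproduct of `S(V)`. -/
theorem coproductAt_factor_self {k : ℕ} {L : Type u} (i : Fin k) :
    (coproductAt i).comp (factor (L := L) i) =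
      (Algebra.TensorProduct.productMap (factor i.castSucc) (factor i.succ)).comp
        (Bialgebra.comulAlgHom ℂ (FieldAlgebra L)) := by
  ext x
  simp [coproductAt, factor, splitVariable, MvPowerSeries.subst_X (hasSubst_splitVariable i)]

theorem coproductAt_factor_of_lt {k : ℕ} {L : Type u} {i j : Fin k} (h : j < i) :
    (coproductAt i).comp (factor (L := L) j) = factor j.castSucc := by
  ext x
  simp [coproductAt, factor, splitVariable, MvPowerSeries.subst_X (hasSubst_splitVariable i), h]

theorem coproductAt_factor_of_gt {k : ℕ} {L : Type u} {i j : Fin k} (h : i < j) :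
    (coproductAt i).comp (factor (L := L) j) = factor j.succ := by
  ext x
  simp [coproductAt, factor, splitVariable, MvPowerSeries.subst_X (hasSubst_splitVariable i), h.not_gt, h.ne']

/-- The formal element `R_{i,j} = ∑_{x,y} K(x,y) φ(x)_i φ(y)_j`, with `K` in the role of the inverse
propagator; the formal sum is taken coefficient by coefficient. -/
def edge {k : ℕ} {L : Type u} (K : L → L → ℂ) (i j : Fin k) : CompletedPower k L :=
  fun m => ∑ᶠ p : L × L, K p.1 p.2 *
    MvPowerSeries.coeff m
      (MvPowerSeries.X (i, p.1) * MvPowerSeries.X (j, p.2) : CompletedPower k L)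

/-- The coefficientwise sum defining `edge` is always finite. -/
theorem edge_summands_finite {k : ℕ} {L : Type u} (K : L → L → ℂ) (i j : Fin k)
    (m : Fin k × L →₀ ℕ) :
    (Function.support fun p : L × L => K p.1 p.2 *
      MvPowerSeries.coeff m
        (MvPowerSeries.X (i, p.1) * MvPowerSeries.X (j, p.2) : CompletedPower k L)).Finite := by
  classical
  refine Set.Finite.subset (((m.support.image Prod.snd).finite_toSet).prod
    ((m.support.image Prod.snd).finite_toSet)) fun p hp => ?_
  have hm : m = Finsupp.single (i, p.1) 1 + Finsupp.single (j, p.2) 1 := by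
    by_contra h
    refine hp ?_
    simp only [MvPowerSeries.X, MvPowerSeries.monomial_mul_monomial, mul_one]
    rw [MvPowerSeries.coeff_monomial, if_neg h, mul_zero]
  constructor
  · exact Finset.mem_coe.2 (Finset.mem_image.2 ⟨(i, p.1), by simp [hm], rfl⟩)
  · exact Finset.mem_coe.2 (Finset.mem_image.2 ⟨(j, p.2), by simp [hm], rfl⟩)

/-- `Q_i = id ⊗ ⋯ ⊗ Q ⊗ ⋯ ⊗ id` with `Q = (1/2) R ∘ Δ`. -/
def Q {k : ℕ} {L : Type u} (K : L → L → ℂ) (i : Fin k) (F : CompletedPower k L) :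
    CompletedPower (k + 1) L :=
  (1 / 2 : ℂ) • (edge K i.castSucc i.succ * coproductAt i F)

/-- `Λ^0 = id` and `Λ^{k+1} = (1/(k+1)) ∑_i Q_i ∘ Λ^k`. -/
def Lambda {L : Type u} (K : L → L → ℂ) : (k : ℕ) → FieldAlgebra L → CompletedPower (k + 1) L
  | 0, a => factor 0 a
  | k + 1, a => (1 / ((k : ℂ) + 1)) • ∑ i : Fin (k + 1), Q K i (Lambda K k a)

/-! ### Ordered graphs -/

/-- A graph with ordered vertices `0, …, k - 1` and external legs `0, …, n - 1`; `mult i j` is the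
number of internal edges between the vertices `i` and `j`, and the leg number `a` is attached to the
vertex `leg a`. -/
@[ext]
structure OrderedGraph (k n : ℕ) where
  mult : Fin k → Fin k → ℕ
  symm : ∀ i j, mult i j = mult j i
  loopless : ∀ i, mult i i = 0
  leg : Fin n → Fin k

namespace OrderedGraph

/-- Permutations act by renumbering the vertices: the vertex `i` becomes the vertex `σ i`. -/
instance (k n : ℕ) : MulAction (Equiv.Perm (Fin k)) (OrderedGraph k n) where
  smul σ Γ :=
    { mult := fun i j => Γ.mult (σ⁻¹ i) (σ⁻¹ j)
      symm := fun _ _ => Γ.symm _ _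
      loopless := fun _ => Γ.loopless _
      leg := fun a => σ (Γ.leg a) }
  one_smul _ := rfl
  mul_smul σ ρ Γ := by
    ext <;> simp [HSMul.hSMul, mul_inv_rev]

/-- The simple graph formed by the vertices and the internal edges. -/
def toSimpleGraph {k n : ℕ} (Γ : OrderedGraph k n) : SimpleGraph (Fin k) where
  Adj i j := Γ.mult i j ≠ 0
  symm := ⟨fun i j h => by rwa [Γ.symm j i]⟩
  loopless := ⟨fun i h => h (Γ.loopless i)⟩

/-- A tree: connected, without cycles, in particular without multiple edges. -/
def IsTree {k n : ℕ} (Γ : OrderedGraph k n) : Prop :=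
  Γ.toSimpleGraph.IsTree ∧ ∀ i j, Γ.mult i j ≤ 1

/-- The order of the group of vertex permutations that fix the ordered graph. -/
def symmetryFactor {k n : ℕ} (Γ : OrderedGraph k n) : ℕ :=
  Nat.card (MulAction.stabilizer (Equiv.Perm (Fin k)) Γ)

/-- The element of the (completed) `S(V)^{⊗ k}` that corresponds to an ordered graph whose leg number
`a` is labelled by `x a`: a factor `R_{i,j}`, `i < j`, for each internal edge, and a factor `φ(x a)`
in the tensor factor of the vertex that carries the leg `a`. -/
def expression {k n : ℕ} {L : Type u} (K : L → L → ℂ) (x : Fin n → L) (Γ : OrderedGraph k n) :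
    CompletedPower k L :=
  (∏ i : Fin k, ∏ j ∈ Finset.Ioi i, edge K i j ^ Γ.mult i j) *
    ∏ a : Fin n, factor (Γ.leg a) (field (x a))

end OrderedGraph

/-- The linear combination `c` of ordered graphs corresponds to `Λ^k(φ(x_1) ⋯ φ(x_n))`, identically
in the set of labels, the symmetric kernel and the labels `x_1, …, x_n`. -/
def IsGraphExpansion (k n : ℕ) (c : OrderedGraph (k + 1) n →₀ ℂ) : Prop :=
  ∀ (L : Type u) (K : L → L → ℂ) (_ : ∀ y z, K y z = K z y) (x : Fin n → L),
    Lambda K k (∏ a : Fin n, field (x a)) = c.sum fun Γ w => w • Γ.expression K x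

/-- The weight of the unordered graph underlying `Γ` in a linear combination `c` of ordered graphs:
the sum of the weights of all ordered graphs that differ from `Γ` by the ordering only. -/
def weight {k n : ℕ} (c : OrderedGraph k n →₀ ℂ) (Γ : OrderedGraph k n) : ℂ :=
  ∑ᶠ Γ' ∈ MulAction.orbit (Equiv.Perm (Fin k)) Γ, c Γ'

end TreeWeight

end

noncomputable section

namespace TreeWeight

open Finset

/-! ### The polynomial model of the expansion -/

/-! Existence. The coproduct of the factor `i` distributes each leg and each edge end at `i` over
the two vertices `i`, `i + 1` into which it splits, so it sums over the fibres of the map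
`i.predAbove` that merges them. Hence `Λ^k(φ(x_1) ⋯ φ(x_n))` is a sum over leg attachments of a
polynomial in the `R_{i,j}` times the leg fields (`Lambda_prod_field`), and the coefficients of
these polynomials are weights of ordered graphs.

Uniqueness. For one suitable choice of labels and kernel the elements of all ordered graphs are
linearly independent, because an evaluation turns them into distinct monomials
(`linearIndependent_expression`).

Weights. By orbit counting, the symmetry factor times the weight of a tree is the sum of the
coefficients of `σ • Γ` over all permutations `σ`, so this sum must be `1`. The recursion for `Λ`
expresses the coefficient of a tree with `k + 2` vertices through the coefficients of its
contractions along the edges that join consecutive vertices, with the factor `1 / (2(k + 1))`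
(`expansion_succ_apply`). Choosing `σ` and a position `i` amounts to choosing an ordered pair of
distinct vertices to be placed at `i`, `i + 1`, and a numbering of the vertices left after merging
them (`insertPerm_bijective`). By induction each ordered pair of adjacent vertices contributes `1`
before the factor. A tree with `k + 2` vertices has `k + 1` edges, hence `2(k + 1)` such pairs, and
the total is `1`. -/

/-- The pairs of vertices that an internal edge can join. -/
abbrev VertexPair (k : ℕ) : Type := {p : Fin k × Fin k // p.1 < p.2}

/-- Polynomials with one variable for each pair of vertices; the monomials are the possible
configurations of internal edges. -/
abbrev EdgePoly (k : ℕ) : Type := MvPolynomial (VertexPair k) ℂ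

/-- The effect of the coproduct of the tensor factor `i` on configurations of internal edges. -/
def splitEdges {k : ℕ} (i : Fin k) : EdgePoly k →ₐ[ℂ] EdgePoly (k + 1) :=
  MvPolynomial.aeval fun s =>
    ∑ t with i.predAbove t.1.1 = s.1.1 ∧ i.predAbove t.1.2 = s.1.2, MvPolynomial.X t

/-- The pair of vertices into which the vertex `i` is split. -/
def newPair {k : ℕ} (i : Fin k) : VertexPair (k + 1) :=
  ⟨(i.castSucc, i.succ), Fin.castSucc_lt_succ⟩

/-- The internal edges in the expansion of `Λ^k`, as a function of the attachment of the legs. -/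
def expansionPoly {n : ℕ} : (k : ℕ) → (Fin n → Fin (k + 1)) → EdgePoly (k + 1)
  | 0, _ => 1
  | k + 1, l => (1 / ((k : ℂ) + 1)) • ∑ i : Fin (k + 1),
      (1 / 2 : ℂ) • (MvPolynomial.X (newPair i) * splitEdges i (expansionPoly k (i.predAbove ∘ l)))

/-- The substitution of the elements `R_{i,j}` for the edge variables. -/
def evalEdges {k : ℕ} {L : Type u} (K : L → L → ℂ) : EdgePoly k →ₐ[ℂ] CompletedPower k L :=
  MvPolynomial.aeval fun s => edge K s.1.1 s.1.2

/-- The map `i.predAbove` merges `i` and `i + 1` and is otherwise one-to-one. This replaces the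
three cases in `splitVariable` by one sum over a fibre, a form that passes through products. -/
theorem sum_predAbove_fiber {k : ℕ} {M : Type*} [AddCommMonoid M] (i j : Fin k)
    (f : Fin (k + 1) → M) :
    ∑ p with i.predAbove p = j, f p =
      if j < i then f j.castSucc else if j = i then f j.castSucc + f j.succ else f j.succ := by
  have key : ∀ p : Fin (k + 1), i.predAbove p = j ↔
      (p = j.castSucc ∧ j ≤ i) ∨ (p = j.succ ∧ i ≤ j) := by
    intro p
    rcases le_or_gt p i.castSucc with h | h
    · have h' : (p : ℕ) ≤ i := h
      rw [Fin.predAbove_of_le_castSucc _ _ h]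
      simp only [Fin.ext_iff, Fin.le_def, Fin.coe_castPred, Fin.val_castSucc, Fin.val_succ]
      omega
    · have h' : (i : ℕ) < p := h
      rw [Fin.predAbove_of_castSucc_lt _ _ h]
      simp only [Fin.ext_iff, Fin.le_def, Fin.val_pred, Fin.val_castSucc, Fin.val_succ]
      omega
  simp only [key]
  split_ifs with h1 h2
  · rw [show (univ.filter fun p : Fin (k + 1) =>
        (p = j.castSucc ∧ j ≤ i) ∨ (p = j.succ ∧ i ≤ j)) = {j.castSucc} by
      ext p; simp [h1.le, h1.not_ge], sum_singleton]
  · rw [show (univ.filter fun p : Fin (k + 1) =>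
        (p = j.castSucc ∧ j ≤ i) ∨ (p = j.succ ∧ i ≤ j)) = {j.castSucc, j.succ} by
      ext p; simp [h2], sum_pair Fin.castSucc_lt_succ.ne]
  · have h3 : i < j := lt_of_le_of_ne (not_lt.1 h1) (Ne.symm h2)
    rw [show (univ.filter fun p : Fin (k + 1) =>
        (p = j.castSucc ∧ j ≤ i) ∨ (p = j.succ ∧ i ≤ j)) = {j.succ} by
      ext p; simp [h3.le, h3.not_ge], sum_singleton]

theorem splitVariable_eq_sum {k : ℕ} {L : Type u} (i j : Fin k) (x : L) :
    splitVariable i (j, x) =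
      ∑ p with i.predAbove p = j, (MvPowerSeries.X (p, x) : CompletedPower (k + 1) L) := by
  rw [sum_predAbove_fiber]
  rfl

theorem coproductAt_X {k : ℕ} {L : Type u} (i j : Fin k) (x : L) :
    coproductAt i (MvPowerSeries.X (j, x)) =
      ∑ p with i.predAbove p = j, (MvPowerSeries.X (p, x) : CompletedPower (k + 1) L) := by
  rw [← splitVariable_eq_sum]
  simp [coproductAt, MvPowerSeries.subst_X (hasSubst_splitVariable i)]

theorem coeff_edge {k : ℕ} {L : Type u} (K : L → L → ℂ) (i j : Fin k) (m : Fin k × L →₀ ℕ) :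
    MvPowerSeries.coeff m (edge K i j) = ∑ᶠ p : L × L, K p.1 p.2 *
      MvPowerSeries.coeff m
        (MvPowerSeries.X (i, p.1) * MvPowerSeries.X (j, p.2) : CompletedPower k L) :=
  rfl

/-- The exponent of the monomial `φ(x)_i φ(y)_j`. -/
def pairExponent {k : ℕ} {L : Type u} (i j : Fin k) (p : L × L) : Fin k × L →₀ ℕ :=
  Finsupp.single (i, p.1) 1 + Finsupp.single (j, p.2) 1

theorem coeff_X_mul_X {k : ℕ} {L : Type u} [DecidableEq L] (i j : Fin k) (p : L × L)
    (m : Fin k × L →₀ ℕ) :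
    MvPowerSeries.coeff m
        (MvPowerSeries.X (i, p.1) * MvPowerSeries.X (j, p.2) : CompletedPower k L) =
      if m = pairExponent i j p then 1 else 0 := by
  simp only [MvPowerSeries.X, MvPowerSeries.monomial_mul_monomial, mul_one]
  rw [MvPowerSeries.coeff_monomial]
  rfl

theorem pairExponent_injective {k : ℕ} {L : Type u} {i j : Fin k} (h : i ≠ j) :
    Function.Injective (pairExponent (L := L) i j) := by
  classical
  rintro ⟨x, y⟩ ⟨x', y'⟩ hxy
  have h1 := DFunLike.congr_fun hxy (i, x)
  have h2 := DFunLike.congr_fun hxy (j, y)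
  simp [pairExponent, Finsupp.single_apply, h, h.symm] at h1 h2
  rw [h1, h2]

theorem coeff_edge_pairExponent {k : ℕ} {L : Type u} (K : L → L → ℂ) {i j : Fin k} (h : i ≠ j)
    (p : L × L) : MvPowerSeries.coeff (pairExponent i j p) (edge K i j) = K p.1 p.2 := by
  classical
  rw [coeff_edge, finsum_eq_single _ p]
  · simp [coeff_X_mul_X]
  · intro q hq
    rw [coeff_X_mul_X, if_neg fun h' => hq (pairExponent_injective h h').symm, mul_zero]

theorem coeff_edge_eq_zero {k : ℕ} {L : Type u} (K : L → L → ℂ) (i j : Fin k)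
    {m : Fin k × L →₀ ℕ} (hm : m ∉ Set.range (pairExponent (L := L) i j)) :
    MvPowerSeries.coeff m (edge K i j) = 0 := by
  classical
  rw [coeff_edge]
  refine finsum_eq_zero_of_forall_eq_zero fun p => ?_
  rw [coeff_X_mul_X, if_neg fun h' => hm ⟨p, h'.symm⟩, mul_zero]

/-- The coefficient of a substituted series is a sum over all exponents. Those of `edge K i j` are
supported on the exponents of `φ(x)_i φ(y)_j`, which for `i ≠ j` determine the pair of labels, so
the sum can be taken over pairs of labels. -/
theorem coeff_coproductAt_edge {k : ℕ} {L : Type u} (K : L → L → ℂ) (r : Fin k) {i j : Fin k}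
    (h : i ≠ j) (m : Fin (k + 1) × L →₀ ℕ) :
    MvPowerSeries.coeff m (coproductAt r (edge K i j)) =
      ∑ᶠ p : L × L, K p.1 p.2 *
        MvPowerSeries.coeff m (splitVariable r (i, p.1) * splitVariable r (j, p.2)) := by
  classical
  rw [coproductAt, MvPowerSeries.substAlgHom_apply,
    MvPowerSeries.coeff_subst (hasSubst_splitVariable r)]
  rw [← finsum_mem_univ, ← finsum_mem_inter_support_eq'
    (s := Set.range (pairExponent (L := L) i j)), finsum_mem_range (pairExponent_injective h)]
  · refine finsum_congr fun p => ?_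
    rw [coeff_edge_pairExponent K h, smul_eq_mul, pairExponent, Finsupp.prod_add_index',
      Finsupp.prod_single_index, Finsupp.prod_single_index] <;> simp [pow_add]
  · intro d hd
    simp only [Set.mem_univ, iff_true]
    by_contra h'
    exact hd (by simp only [coeff_edge_eq_zero K i j h', zero_smul])

theorem coproductAt_edge {k : ℕ} {L : Type u} (K : L → L → ℂ) (r : Fin k) {i j : Fin k}
    (h : i ≠ j) :
    coproductAt r (edge K i j) =
      ∑ p with r.predAbove p = i, ∑ q with r.predAbove q = j, edge K p q := by
  ext m
  rw [coeff_coproductAt_edge K r h]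
  simp only [splitVariable_eq_sum]
  simp only [sum_mul_sum]
  simp only [map_sum, mul_sum, coeff_edge]
  rw [finsum_sum_comm]
  · refine sum_congr rfl fun p _ => ?_
    rw [finsum_sum_comm]
    exact fun q _ => edge_summands_finite K p q m
  · intro p _
    have := Set.Finite.biUnion (Finset.finite_toSet {q | r.predAbove q = j})
      fun q _ => edge_summands_finite K p q m
    refine this.subset fun z hz => ?_
    obtain ⟨q, hq, h0⟩ := exists_ne_zero_of_sum_ne_zero hz
    exact Set.mem_biUnion (mem_coe.2 hq) h0

theorem coproductAt_evalEdges {k : ℕ} {L : Type u} (K : L → L → ℂ) (r : Fin k) (P : EdgePoly k) :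
    coproductAt r (evalEdges K P) = evalEdges K (splitEdges r P) := by
  suffices h : (coproductAt r).comp (evalEdges K) = (evalEdges K).comp (splitEdges r) from
    DFunLike.congr_fun h P
  refine MvPolynomial.algHom_ext fun s => ?_
  simp only [AlgHom.comp_apply, evalEdges, splitEdges, MvPolynomial.aeval_X, map_sum]
  rw [coproductAt_edge K r s.2.ne, ← sum_product']
  refine (sum_bij (fun t _ => t.1) ?_ ?_ ?_ ?_).symm
  · intro t ht
    simpa using ht
  · exact fun a _ b _ hab => Subtype.ext hab
  · rintro ⟨p, q⟩ hpq
    simp only [mem_product, mem_filter, mem_univ, true_and] at hpq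
    refine ⟨⟨(p, q), ?_⟩, by simpa using hpq, rfl⟩
    -- Monotonicity of `predAbove`: a pair of vertices lying over an increasing pair is itself
    -- increasing, so no `R_{p,q}` with `p ≥ q` occurs.
    by_contra hle
    have := Fin.predAbove_right_monotone r (not_lt.1 hle)
    rw [hpq.1, hpq.2] at this
    exact absurd s.2 this.not_gt
  · exact fun _ _ => rfl

theorem coproductAt_prod_X {k n : ℕ} {L : Type u} (r : Fin k) (x : Fin n → L) (l : Fin n → Fin k) :
    coproductAt r (∏ a, MvPowerSeries.X (l a, x a)) =
      ∑ l' : Fin n → Fin (k + 1) with r.predAbove ∘ l' = l,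
        ∏ a, (MvPowerSeries.X (l' a, x a) : CompletedPower (k + 1) L) := by
  simp only [map_prod, coproductAt_X]
  rw [prod_univ_sum]
  refine sum_congr ?_ fun _ _ => rfl
  ext l'
  simp [funext_iff]

theorem Lambda_prod_field {n : ℕ} {L : Type u} (K : L → L → ℂ) (x : Fin n → L) (k : ℕ) :
    Lambda K k (∏ a, field (x a)) =
      ∑ l : Fin n → Fin (k + 1), evalEdges K (expansionPoly k l) *
        ∏ a, MvPowerSeries.X (l a, x a) := by
  induction k with
  | zero =>
    simp only [Lambda, map_prod, factor_field, expansionPoly, map_one, one_mul]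
    rw [Fintype.sum_eq_single (fun _ => 0) fun l hl =>
      absurd (funext fun a => Subsingleton.elim (α := Fin 1) _ _) hl]
  | succ k ih =>
    simp only [Lambda, ih, Q, expansionPoly, map_smul, map_sum, map_mul, smul_mul_assoc]
    simp only [sum_mul, smul_mul_assoc]
    simp only [← smul_sum]
    congr 2
    rw [sum_comm]
    refine sum_congr rfl fun i _ => ?_
    simp only [coproductAt_evalEdges, coproductAt_prod_X, mul_sum]
    have he : evalEdges K (MvPolynomial.X (newPair i)) = edge K i.castSucc i.succ := by
      simp [evalEdges, newPair]
    -- Each new attachment `l'` of the legs comes from exactly one old attachment, namely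
    -- `i.predAbove ∘ l'`.
    rw [he, ← sum_fiberwise (s := univ) (g := fun l' : Fin n → Fin (k + 2) => i.predAbove ∘ l')]
    refine sum_congr rfl fun l _ => sum_congr rfl fun l' hl' => ?_
    rw [(mem_filter.1 hl').2, mul_assoc]

/-! ### Existence of the expansion -/

namespace OrderedGraph

/-- The multiplicities of the internal edges as the exponent of a monomial. -/
def exponent {k n : ℕ} (Γ : OrderedGraph k n) : VertexPair k →₀ ℕ :=
  Finsupp.equivFunOnFinite.symm fun s => Γ.mult s.1.1 s.1.2

@[simp]
theorem exponent_apply {k n : ℕ} (Γ : OrderedGraph k n) (s : VertexPair k) :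
    Γ.exponent s = Γ.mult s.1.1 s.1.2 :=
  rfl

/-- The ordered graph with given legs and given multiplicities of the internal edges. -/
def ofExponent {k n : ℕ} (l : Fin n → Fin k) (d : VertexPair k →₀ ℕ) : OrderedGraph k n where
  mult i j := if h : i < j then d ⟨(i, j), h⟩ else if h : j < i then d ⟨(j, i), h⟩ else 0
  symm i j := by
    rcases lt_trichotomy i j with h | h | h
    · simp [h, h.not_gt]
    · simp [h]
    · simp [h, h.not_gt]
  loopless i := by simp
  leg := l

theorem exponent_ofExponent {k n : ℕ} (l : Fin n → Fin k) (d : VertexPair k →₀ ℕ) :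
    (ofExponent l d).exponent = d := by
  ext s
  simp [ofExponent, s.2]

theorem ext_of_exponent {k n : ℕ} {Γ Γ' : OrderedGraph k n} (hl : Γ.leg = Γ'.leg)
    (hd : Γ.exponent = Γ'.exponent) : Γ = Γ' := by
  refine OrderedGraph.ext (funext fun i => funext fun j => ?_) hl
  rcases lt_trichotomy i j with h | h | h
  · exact DFunLike.congr_fun hd ⟨(i, j), h⟩
  · rw [h, Γ.loopless, Γ'.loopless]
  · rw [Γ.symm, Γ'.symm]
    exact DFunLike.congr_fun hd ⟨(j, i), h⟩

theorem ofExponent_eq_iff {k n : ℕ} (l : Fin n → Fin k) (d : VertexPair k →₀ ℕ)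
    (Γ : OrderedGraph k n) : ofExponent l d = Γ ↔ l = Γ.leg ∧ d = Γ.exponent := by
  refine ⟨?_, fun ⟨hl, hd⟩ => ext_of_exponent hl ((exponent_ofExponent l d).trans hd)⟩
  rintro rfl
  exact ⟨rfl, (exponent_ofExponent l d).symm⟩

theorem prod_prod_pow_mult {k n : ℕ} {A : Type*} [CommMonoid A] (Γ : OrderedGraph k n)
    (f : Fin k → Fin k → A) :
    ∏ i : Fin k, ∏ j ∈ Ioi i, f i j ^ Γ.mult i j =
      Γ.exponent.prod fun s m => f s.1.1 s.1.2 ^ m := by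
  rw [Finsupp.prod_fintype _ _ fun _ => pow_zero _, prod_sigma']
  refine prod_bij' (fun p hp => ⟨(p.1, p.2), by simpa using hp⟩) (fun s _ => ⟨s.1.1, s.1.2⟩)
    ?_ ?_ ?_ ?_ ?_
  · simp
  · exact fun s _ => by simpa using s.2
  · simp
  · simp
  · simp

theorem expression_eq {k n : ℕ} {L : Type u} (K : L → L → ℂ) (x : Fin n → L)
    (Γ : OrderedGraph k n) :
    Γ.expression K x = evalEdges K (MvPolynomial.monomial Γ.exponent 1) *
      ∏ a, MvPowerSeries.X (Γ.leg a, x a) := by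
  simp only [expression, factor_field, prod_prod_pow_mult, evalEdges, MvPolynomial.aeval_monomial,
    map_one, one_mul]

end OrderedGraph

/-- The weights of the ordered graphs in the expansion of `Λ^k(φ(x_1) ⋯ φ(x_n))`. -/
def expansion (k n : ℕ) : OrderedGraph (k + 1) n →₀ ℂ :=
  ∑ l : Fin n → Fin (k + 1), ∑ d ∈ (expansionPoly k l).support,
    Finsupp.single (OrderedGraph.ofExponent l d) ((expansionPoly k l).coeff d)

theorem expansion_apply (k n : ℕ) (Γ : OrderedGraph (k + 1) n) :
    expansion k n Γ = (expansionPoly k Γ.leg).coeff Γ.exponent := by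
  classical
  simp only [expansion, Finsupp.finsetSum_apply, Finsupp.single_apply,
    OrderedGraph.ofExponent_eq_iff]
  rw [Fintype.sum_eq_single Γ.leg fun l hl => sum_eq_zero fun d _ => if_neg fun h => hl h.1]
  simp only [true_and, sum_ite_eq', MvPolynomial.mem_support_iff]
  split_ifs with h
  · rfl
  · exact (not_not.1 h).symm

theorem isGraphExpansion_expansion (k n : ℕ) : IsGraphExpansion.{u} k n (expansion k n) := by
  intro L K _ x
  rw [Lambda_prod_field]
  change _ = Finsupp.linearCombination ℂ (OrderedGraph.expression K x) (expansion k n)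
  simp only [expansion, map_sum, Finsupp.linearCombination_single, OrderedGraph.expression_eq,
    OrderedGraph.exponent_ofExponent]
  refine sum_congr rfl fun l _ => ?_
  conv_lhs => rw [(expansionPoly k l).as_sum, map_sum, sum_mul]
  refine sum_congr rfl fun d _ => ?_
  rw [← smul_mul_assoc, ← map_smul, MvPolynomial.smul_monomial, smul_eq_mul, mul_one]
  rfl

/-! ### Uniqueness of the expansion -/

/-- The labels that separate ordered graphs: one for each leg, and a dual pair of labels for each
vertex. -/
abbrev SeparatingLabel (k n : ℕ) : Type u := ULift.{u} (Fin n ⊕ (Fin k ⊕ Fin k))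

/-- The kernel that pairs the two labels of each vertex. -/
def separatingKernel {k n : ℕ} : SeparatingLabel.{u} k n → SeparatingLabel.{u} k n → ℂ
  | ⟨.inr (.inl i)⟩, ⟨.inr (.inr j)⟩ => if i = j then 1 else 0
  | ⟨.inr (.inr i)⟩, ⟨.inr (.inl j)⟩ => if i = j then 1 else 0
  | _, _ => 0

theorem separatingKernel_symm {k n : ℕ} (y z : SeparatingLabel.{u} k n) :
    separatingKernel y z = separatingKernel z y := by
  rcases y with ⟨_ | _ | _⟩ <;> rcases z with ⟨_ | _ | _⟩ <;> simp [separatingKernel, eq_comm]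

/-- The polynomial form of `edge` for a finite set of labels. -/
def polyEdge {k : ℕ} {L : Type u} [Fintype L] (K : L → L → ℂ) (i j : Fin k) :
    MvPolynomial (Fin k × L) ℂ :=
  ∑ p : L × L, K p.1 p.2 • (MvPolynomial.X (i, p.1) * MvPolynomial.X (j, p.2))

theorem coe_polyEdge {k : ℕ} {L : Type u} [Fintype L] (K : L → L → ℂ) (i j : Fin k) :
    (polyEdge K i j : CompletedPower k L) = edge K i j := by
  ext m
  rw [coeff_edge, finsum_eq_sum_of_fintype, MvPolynomial.coeff_coe, polyEdge,
    MvPolynomial.coeff_sum]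
  refine sum_congr rfl fun p _ => ?_
  rw [MvPolynomial.coeff_smul, smul_eq_mul, ← MvPolynomial.coeff_coe, MvPolynomial.coe_mul,
    MvPolynomial.coe_X, MvPolynomial.coe_X]

/-- The polynomial form of `OrderedGraph.expression` for a finite set of labels. -/
def polyExpression {k n : ℕ} {L : Type u} [Fintype L] (K : L → L → ℂ) (x : Fin n → L)
    (Γ : OrderedGraph k n) : MvPolynomial (Fin k × L) ℂ :=
  (Γ.exponent.prod fun s m => polyEdge K s.1.1 s.1.2 ^ m) * ∏ a, MvPolynomial.X (Γ.leg a, x a)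

theorem coe_polyExpression {k n : ℕ} {L : Type u} [Fintype L] (K : L → L → ℂ) (x : Fin n → L)
    (Γ : OrderedGraph k n) : (polyExpression K x Γ : CompletedPower k L) = Γ.expression K x := by
  rw [OrderedGraph.expression_eq, evalEdges, MvPolynomial.aeval_monomial, map_one, one_mul,
    polyExpression, ← MvPolynomial.coeToMvPowerSeries.ringHom_apply, map_mul, Finsupp.prod,
    map_prod, map_prod]
  simp only [map_pow, MvPolynomial.coeToMvPowerSeries.ringHom_apply, coe_polyEdge,
    MvPolynomial.coe_X]
  rfl

/-- The variables for the internal edges and for the legs of ordered graphs. -/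
abbrev GraphVariable (k n : ℕ) : Type := VertexPair k ⊕ (Fin n × Fin k)

/-- The evaluation under which the expressions of ordered graphs become distinct monomials. -/
def separatingPoint {k n : ℕ} : Fin k × SeparatingLabel.{u} k n → MvPolynomial (GraphVariable k n) ℂ
  | (i, ⟨.inl a⟩) => MvPolynomial.X (.inr (a, i))
  | (i, ⟨.inr (.inl j)⟩) => if i = j then 1 else 0
  | (i, ⟨.inr (.inr j)⟩) => if h : j < i then MvPolynomial.X (.inl ⟨(j, i), h⟩) else 0

/-- For `i < j`, the kernel leaves two terms for each vertex `v`: first label of `v` at `i` and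
second at `j`, or the reverse. The first survives only for `v = i` and gives the variable of the
pair `(i, j)`. The reverse would need `v = j` and `j < i`, so it vanishes. -/
theorem aeval_polyEdge {k n : ℕ} (s : VertexPair k) :
    MvPolynomial.aeval separatingPoint.{u} (polyEdge (separatingKernel (n := n)) s.1.1 s.1.2) =
      MvPolynomial.X (.inl s) := by
  rw [polyEdge, map_sum, Fintype.sum_prod_type]
  simp only [map_smul, map_mul, MvPolynomial.aeval_X]
  rw [← Equiv.ulift.symm.sum_comp]
  simp_rw [← Equiv.ulift.symm.sum_comp (fun z => separatingKernel _ z •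
    (separatingPoint _ * separatingPoint (s.1.2, z)))]
  simp only [Equiv.ulift_symm_apply, Fintype.sum_sum_type, separatingKernel, separatingPoint,
    zero_smul, sum_const_zero, zero_add, add_zero]
  rw [Fintype.sum_eq_single s.1.1, Fintype.sum_eq_single s.1.1, sum_eq_zero, add_zero]
  · simp [s.2]
  · intro x _
    refine sum_eq_zero fun y _ => ?_
    split_ifs with h1 h2 h3 <;> simp
    subst h1 h3
    exact absurd s.2 h2.not_gt
  · intro y hy
    simp [hy.symm]
  · intro y hy
    simp [hy.symm]

/-- The internal edges and the legs of an ordered graph as the exponent of a monomial. -/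
def fullExponent {k n : ℕ} (Γ : OrderedGraph k n) : GraphVariable k n →₀ ℕ :=
  Γ.exponent.mapDomain Sum.inl + ∑ a, Finsupp.single (.inr (a, Γ.leg a)) 1

theorem fullExponent_inl {k n : ℕ} (Γ : OrderedGraph k n) (s : VertexPair k) :
    fullExponent Γ (.inl s) = Γ.exponent s := by
  classical
  simp [fullExponent, Finsupp.mapDomain_apply Sum.inl_injective]

theorem fullExponent_inr {k n : ℕ} (Γ : OrderedGraph k n) (a : Fin n) (i : Fin k) :
    fullExponent Γ (.inr (a, i)) = if Γ.leg a = i then 1 else 0 := by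
  classical
  rw [fullExponent, Finsupp.add_apply, Finsupp.mapDomain_of_notMem_range _ _ (by simp), zero_add,
    Finsupp.finsetSum_apply, Fintype.sum_eq_single a]
  · simp [Finsupp.single_apply]
  · intro b hb
    simp [hb]

theorem fullExponent_injective {k n : ℕ} :
    Function.Injective (fullExponent : OrderedGraph k n → _) := by
  intro Γ Γ' h
  refine OrderedGraph.ext_of_exponent (funext fun a => ?_) (Finsupp.ext fun s => ?_)
  · have := DFunLike.congr_fun h (.inr (a, Γ'.leg a))
    simp only [fullExponent_inr, if_true] at this
    by_contra hne
    simp [hne] at this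
  · rw [← fullExponent_inl, h, fullExponent_inl]

theorem aeval_polyExpression {k n : ℕ} (Γ : OrderedGraph k n) :
    MvPolynomial.aeval separatingPoint.{u} (polyExpression separatingKernel
      (fun a => ⟨.inl a⟩) Γ) = MvPolynomial.monomial (fullExponent Γ) 1 := by
  have hX : ∀ a, MvPolynomial.aeval separatingPoint.{u}
      (MvPolynomial.X (Γ.leg a, ⟨.inl a⟩) : MvPolynomial (Fin k × SeparatingLabel.{u} k n) ℂ) =
      (MvPolynomial.X (.inr (a, Γ.leg a)) : MvPolynomial (GraphVariable k n) ℂ) :=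
    fun a => by rw [MvPolynomial.aeval_X, separatingPoint]
  rw [polyExpression, map_mul, Finsupp.prod, map_prod, map_prod]
  simp only [map_pow, aeval_polyEdge, hX]
  rw [fullExponent, ← one_mul (1 : ℂ), ← MvPolynomial.monomial_mul, MvPolynomial.monomial_sum_one,
    Finsupp.mapDomain, Finsupp.sum, MvPolynomial.monomial_sum_one]
  simp only [MvPolynomial.X_pow_eq_monomial]
  rfl

/-- The separating evaluation has nonzero constants among its values, so it is applied to
polynomials rather than power series. There the graphs become distinct monomials, and independence
passes to power series because the inclusion of polynomials is injective. -/
theorem linearIndependent_expression (k n : ℕ) :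
    LinearIndependent ℂ fun Γ : OrderedGraph k n =>
      Γ.expression (separatingKernel.{u} (k := k) (n := n)) fun a => ⟨.inl a⟩ := by
  have h1 : LinearIndependent ℂ fun Γ : OrderedGraph k n =>
      polyExpression (separatingKernel.{u} (k := k) (n := n)) (fun a => ⟨.inl a⟩) Γ := by
    refine LinearIndependent.of_comp (MvPolynomial.aeval separatingPoint.{u}).toLinearMap ?_
    have h := (MvPolynomial.basisMonomials (GraphVariable k n) ℂ).linearIndependent.comp _
      (fullExponent_injective (k := k) (n := n))
    have heq : (MvPolynomial.aeval separatingPoint.{u}).toLinearMap ∘ (fun Γ : OrderedGraph k n =>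
        polyExpression (separatingKernel.{u} (k := k) (n := n)) (fun a => ⟨.inl a⟩) Γ) =
        MvPolynomial.basisMonomials (GraphVariable k n) ℂ ∘ fullExponent := by
      funext Γ
      simp only [Function.comp_apply, MvPolynomial.coe_basisMonomials]
      exact aeval_polyExpression Γ
    rw [heq]
    exact h
  have hcoe : ∀ P : MvPolynomial (Fin k × SeparatingLabel.{u} k n) ℂ,
      (MvPolynomial.coeToMvPowerSeries.algHom ℂ).toLinearMap P =
        (P : CompletedPower k (SeparatingLabel.{u} k n)) := fun P => by simp
  have h2 := h1.map_injOn (MvPolynomial.coeToMvPowerSeries.algHom ℂ).toLinearMap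
    fun P _ P' _ h => MvPolynomial.coe_injective _ _ (by rwa [hcoe, hcoe] at h)
  simp only [Function.comp_def, hcoe, coe_polyExpression] at h2
  exact h2

theorem existsUnique_isGraphExpansion (k n : ℕ) :
    ∃! c : OrderedGraph (k + 1) n →₀ ℂ, IsGraphExpansion.{u} k n c := by
  refine ⟨expansion k n, isGraphExpansion_expansion k n, fun c hc => ?_⟩
  refine linearIndependent_expression.{u} (k + 1) n ?_
  exact (hc _ _ separatingKernel_symm _).symm.trans
    (isGraphExpansion_expansion k n _ _ separatingKernel_symm _)

/-! ### Contraction of edges -/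

namespace OrderedGraph

/-- The image of an ordered graph under a map of the vertices; edges that become loops are
removed. -/
def contract {k m n : ℕ} (f : Fin k → Fin m) (Γ : OrderedGraph k n) : OrderedGraph m n where
  mult p q := if p = q then 0 else
    ∑ t : Fin k × Fin k with f t.1 = p ∧ f t.2 = q, Γ.mult t.1 t.2
  symm p q := by
    simp only [eq_comm (a := p)]
    congr 1
    refine sum_equiv (Equiv.prodComm _ _) ?_ fun t _ => Γ.symm _ _
    simp [and_comm]
  loopless p := if_pos rfl
  leg := f ∘ Γ.leg

theorem smul_mult {k n : ℕ} (σ : Equiv.Perm (Fin k)) (Γ : OrderedGraph k n) (i j : Fin k) :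
    (σ • Γ).mult i j = Γ.mult (σ⁻¹ i) (σ⁻¹ j) :=
  rfl

theorem contract_smul {k m n : ℕ} (f : Fin k → Fin m) (σ : Equiv.Perm (Fin k))
    (Γ : OrderedGraph k n) : (σ • Γ).contract f = Γ.contract (f ∘ σ) := by
  refine OrderedGraph.ext (funext fun p => funext fun q => ?_) rfl
  simp only [contract, smul_mult]
  congr 1
  refine sum_equiv (σ⁻¹.prodCongr σ⁻¹) ?_ fun t _ => rfl
  simp

theorem contract_perm_comp {k m n : ℕ} (f : Fin k → Fin m) (τ : Equiv.Perm (Fin m))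
    (Γ : OrderedGraph k n) : Γ.contract (τ ∘ f) = τ • Γ.contract f := by
  refine OrderedGraph.ext (funext fun p => funext fun q => ?_) rfl
  simp only [contract, smul_mult, Function.comp_apply, Equiv.Perm.eq_inv_iff_eq]
  rw [← Equiv.Perm.mul_apply, mul_inv_cancel, Equiv.Perm.one_apply]

theorem contract_mult_ne_zero_iff {k m n : ℕ} (f : Fin k → Fin m) (Γ : OrderedGraph k n)
    {p q : Fin m} (h : p ≠ q) :
    (Γ.contract f).mult p q ≠ 0 ↔ ∃ i j, f i = p ∧ f j = q ∧ Γ.mult i j ≠ 0 := by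
  simp only [contract, if_neg h, ne_eq, sum_eq_zero_iff, mem_filter, mem_univ, true_and]
  push Not
  simp [and_assoc]

theorem sum_mult_contract {k m n : ℕ} (f : Fin k → Fin m) (Γ : OrderedGraph k n) :
    ∑ s : Fin m × Fin m, (Γ.contract f).mult s.1 s.2 =
      ∑ t : Fin k × Fin k, if f t.1 = f t.2 then 0 else Γ.mult t.1 t.2 := by
  rw [← sum_fiberwise (s := univ) (g := fun t : Fin k × Fin k => (f t.1, f t.2))]
  refine sum_congr rfl fun s _ => ?_
  simp only [contract, Prod.ext_iff]
  split_ifs with h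
  · refine (sum_eq_zero fun t ht => if_pos ?_).symm
    rw [mem_filter] at ht
    rw [ht.2.1, ht.2.2, h]
  · refine sum_congr rfl fun t ht => (if_neg ?_).symm
    rw [mem_filter] at ht
    rwa [ht.2.1, ht.2.2]

/-- The map `f` is onto and identifies exactly the vertices `a` and `b`. -/
structure Identifies {k m : ℕ} (f : Fin k → Fin m) (a b : Fin k) : Prop where
  surjective : Function.Surjective f
  ne : a ≠ b
  eq_iff : ∀ p q, f p = f q ↔ p = q ∨ (p = a ∧ q = b) ∨ (p = b ∧ q = a)

/-- Only the edges between `a` and `b` become loops and are lost. The sums run over ordered pairs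
and count every edge twice. -/
theorem sum_mult_contract_add {k m n : ℕ} {f : Fin k → Fin m} {a b : Fin k}
    (hf : Identifies f a b) (Γ : OrderedGraph k n) :
    ∑ s : Fin m × Fin m, (Γ.contract f).mult s.1 s.2 + 2 * Γ.mult a b =
      ∑ t : Fin k × Fin k, Γ.mult t.1 t.2 := by
  have hne : ((a, b) : Fin k × Fin k) ≠ (b, a) := fun h => hf.ne (congrArg Prod.fst h)
  have h2 : 2 * Γ.mult a b = ∑ t : Fin k × Fin k,
      if t ∈ ({(a, b), (b, a)} : Finset (Fin k × Fin k)) then Γ.mult t.1 t.2 else 0 := by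
    rw [sum_ite_mem, univ_inter, sum_pair hne, Γ.symm b a, two_mul]
  rw [sum_mult_contract, h2, ← sum_add_distrib]
  refine sum_congr rfl fun t _ => ?_
  obtain ⟨p, q⟩ := t
  simp only [hf.eq_iff, mem_insert, mem_singleton, Prod.mk.injEq]
  by_cases h1 : p = q
  · subst h1
    simp [Γ.loopless]
  · by_cases h3 : (p = a ∧ q = b) ∨ (p = b ∧ q = a) <;> simp [h1, h3]

theorem sum_adj_eq {k n : ℕ} (Γ : OrderedGraph k n) :
    ∑ t : Fin k × Fin k, (if Γ.mult t.1 t.2 ≠ 0 then 1 else 0) =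
      2 * Nat.card Γ.toSimpleGraph.edgeSet := by
  classical
  have := Γ.toSimpleGraph.two_mul_card_edgeFinset
  rw [Nat.card_eq_fintype_card, ← SimpleGraph.edgeFinset_card, this, card_filter]
  exact sum_congr rfl fun t _ => if_congr Iff.rfl rfl rfl

theorem ite_adj_le_mult {k n : ℕ} (Γ : OrderedGraph k n) (t : Fin k × Fin k) :
    (if Γ.mult t.1 t.2 ≠ 0 then 1 else 0) ≤ Γ.mult t.1 t.2 := by
  split_ifs with h
  · exact Nat.one_le_iff_ne_zero.2 h
  · exact Nat.zero_le _

/-- A connected graph on `k + 1` vertices has at least `k` adjacent pairs, each of multiplicity at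
least one. A total of `k` edges with multiplicity forces equality in both bounds. This form of the
tree property is easy to follow under contraction. -/
theorem isTree_iff {k n : ℕ} (Γ : OrderedGraph (k + 1) n) :
    Γ.IsTree ↔ Γ.toSimpleGraph.Connected ∧
      ∑ t : Fin (k + 1) × Fin (k + 1), Γ.mult t.1 t.2 = 2 * k := by
  have hs := Γ.sum_adj_eq
  rw [IsTree, SimpleGraph.isTree_iff_connected_and_card, Nat.card_fin]
  constructor
  · rintro ⟨⟨hc, hcard⟩, h1⟩
    refine ⟨hc, ?_⟩
    refine Eq.trans ?_ (hs.trans (congrArg (2 * ·) (Nat.succ_injective hcard)))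
    refine sum_congr rfl fun t _ => ?_
    have := h1 t.1 t.2
    split_ifs with h <;> omega
  · rintro ⟨hc, hsum⟩
    have hle := sum_le_sum fun t (_ : t ∈ univ) => Γ.ite_adj_le_mult t
    have hge := hc.card_vert_le_card_edgeSet_add_one
    rw [Nat.card_fin] at hge
    refine ⟨⟨hc, by omega⟩, fun i j => ?_⟩
    have heq := (sum_eq_sum_iff_of_le fun t (_ : t ∈ univ) => Γ.ite_adj_le_mult t).1 (by omega)
      (i, j) (mem_univ _)
    simp only at heq
    split_ifs at heq <;> omega

/-- Walks map to walks, so connectedness survives; exactly one edge and one vertex are lost. -/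
theorem IsTree.contract {k n : ℕ} {Γ : OrderedGraph (k + 2) n} (hΓ : Γ.IsTree)
    {f : Fin (k + 2) → Fin (k + 1)} {a b : Fin (k + 2)} (hf : Identifies f a b)
    (hab : Γ.mult a b ≠ 0) : (Γ.contract f).IsTree := by
  have h1 : Γ.mult a b = 1 := le_antisymm (hΓ.2 a b) (Nat.one_le_iff_ne_zero.2 hab)
  obtain ⟨hc, hsum⟩ := Γ.isTree_iff.1 hΓ
  refine (isTree_iff _).2 ⟨?_, ?_⟩
  · have hreach : ∀ p q, Γ.toSimpleGraph.Reachable p q →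
        (Γ.contract f).toSimpleGraph.Reachable (f p) (f q) := by
      rintro p q ⟨w⟩
      induction w with
      | nil => exact SimpleGraph.Reachable.refl _
      | @cons p q r hadj _ ih =>
        refine SimpleGraph.Reachable.trans ?_ ih
        by_cases h : f p = f q
        · rw [h]
        · exact SimpleGraph.Adj.reachable
            ((contract_mult_ne_zero_iff f Γ h).2 ⟨p, q, rfl, rfl, hadj⟩)
    refine (SimpleGraph.connected_iff _).2 ⟨fun p q => ?_, ⟨0⟩⟩
    obtain ⟨p, rfl⟩ := hf.surjective p
    obtain ⟨q, rfl⟩ := hf.surjective q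
    exact hreach p q (hc.preconnected p q)
  · have := (sum_mult_contract_add hf Γ).trans hsum
    omega

theorem IsTree.smul {k n : ℕ} {Γ : OrderedGraph (k + 1) n} (hΓ : Γ.IsTree)
    (σ : Equiv.Perm (Fin (k + 1))) : (σ • Γ).IsTree := by
  refine ⟨?_, fun i j => hΓ.2 _ _⟩
  have e : (σ • Γ).toSimpleGraph ≃g Γ.toSimpleGraph := ⟨σ⁻¹, Iff.rfl⟩
  exact e.isTree_iff.2 hΓ.1

end OrderedGraph

open OrderedGraph

theorem identifies_predAbove {k : ℕ} (i : Fin (k + 1)) :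
    Identifies i.predAbove i.castSucc i.succ where
  surjective := fun p => ⟨_, Fin.predAbove_succAbove i p⟩
  ne := Fin.castSucc_lt_succ.ne
  eq_iff p q := by
    constructor
    · intro h
      rcases le_or_gt p i.castSucc with hp | hp <;> rcases le_or_gt q i.castSucc with hq | hq <;>
      simp only [Fin.predAbove_of_le_castSucc, Fin.predAbove_of_castSucc_lt, hp, hq, Fin.ext_iff,
        Fin.coe_castPred, Fin.val_pred] at h <;>
      simp only [Fin.le_def, Fin.lt_def, Fin.val_castSucc] at hp hq <;>
      simp only [Fin.ext_iff, Fin.val_castSucc, Fin.val_succ] <;> omega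
    · rintro (rfl | ⟨rfl, rfl⟩ | ⟨rfl, rfl⟩) <;> simp

theorem predAbove_lt_predAbove {k : ℕ} {i : Fin (k + 1)} {t : VertexPair (k + 2)}
    (ht : t ≠ newPair i) : i.predAbove t.1.1 < i.predAbove t.1.2 := by
  refine lt_of_le_of_ne (Fin.predAbove_right_monotone i t.2.le) fun h => ?_
  rcases ((identifies_predAbove i).eq_iff _ _).1 h with h | ⟨h1, h2⟩ | ⟨h1, h2⟩
  · exact t.2.ne h
  · exact ht (Subtype.ext (Prod.ext h1 h2))
  · have := t.2
    rw [h1, h2] at this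
    exact this.not_gt Fin.castSucc_lt_succ

/-! ### The weights of trees -/

/-- Setting the variables outside the range of `f` to zero does not affect the coefficient. After
that, the sum substituted for `s` reduces to the variable of the unique `e` with `h e = s`, or to
zero, which is what killing the variables outside the range of `h` does to `P`. -/
theorem coeff_aeval_sum_X {σ τ E R : Type*} [CommSemiring R] (T : σ → Finset τ) {f : E → τ}
    {h : E → σ} (hf : Function.Injective f) (hh : Function.Injective h)
    (hT : ∀ e s, f e ∈ T s ↔ h e = s) (P : MvPolynomial σ R) (d : E →₀ ℕ) :
    (MvPolynomial.aeval (fun s => ∑ t ∈ T s, (MvPolynomial.X t : MvPolynomial τ R)) P).coeff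
      (d.mapDomain f) = P.coeff (d.mapDomain h) := by
  rw [← MvPolynomial.coeff_killCompl hf, ← MvPolynomial.coeff_killCompl hh]
  congr 1
  rw [← AlgHom.comp_apply]
  congr 1
  refine MvPolynomial.algHom_ext fun s => ?_
  rw [AlgHom.comp_apply, MvPolynomial.aeval_X, map_sum]
  by_cases hs : s ∈ Set.range h
  · obtain ⟨e, rfl⟩ := hs
    rw [sum_eq_single (f e)]
    · rw [← MvPolynomial.rename_X, ← MvPolynomial.rename_X h, MvPolynomial.killCompl_rename_app,
        MvPolynomial.killCompl_rename_app]
    · intro t ht hne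
      rw [MvPolynomial.killCompl, MvPolynomial.aeval_X, dif_neg]
      rintro ⟨e', rfl⟩
      exact hne (congrArg f (hh ((hT _ _).1 ht)))
    · exact fun h' => absurd ((hT _ _).2 rfl) h'
  · rw [MvPolynomial.killCompl, MvPolynomial.killCompl, MvPolynomial.aeval_X, dif_neg hs]
    refine sum_eq_zero fun t ht => ?_
    rw [MvPolynomial.aeval_X, dif_neg]
    rintro ⟨e, rfl⟩
    exact hs ⟨e, (hT _ _).1 ht⟩

theorem mapDomain_one_apply {E τ : Type*} [Finite E] {f : E → τ} (hf : Function.Injective f)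
    (t : τ) [Decidable (t ∈ Set.range f)] :
    (Finsupp.equivFunOnFinite.symm (1 : E → ℕ)).mapDomain f t =
      if t ∈ Set.range f then 1 else 0 := by
  split_ifs with h
  · obtain ⟨e, rfl⟩ := h
    rw [Finsupp.mapDomain_apply hf]
    rfl
  · exact Finsupp.mapDomain_of_notMem_range _ _ h

/-- No multinomial factor appears: each edge of the contracted tree comes from exactly one edge of
`Γ`, so only one monomial of `P` contributes, and in one way. -/
theorem coeff_splitEdges {k n : ℕ} {Γ : OrderedGraph (k + 2) n} (hΓ : Γ.IsTree) {i : Fin (k + 1)}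
    (hi : Γ.mult i.castSucc i.succ ≠ 0) (P : EdgePoly (k + 1)) :
    (splitEdges i P).coeff (Γ.exponent - Finsupp.single (newPair i) 1) =
      P.coeff (Γ.contract i.predAbove).exponent := by
  classical
  have hC := hΓ.contract (identifies_predAbove i) hi
  let E := {t : VertexPair (k + 2) // Γ.mult t.1.1 t.1.2 ≠ 0 ∧ t ≠ newPair i}
  let h : E → VertexPair (k + 1) := fun t =>
    ⟨(i.predAbove t.1.1.1, i.predAbove t.1.1.2), predAbove_lt_predAbove t.2.2⟩
  -- Two edges of `Γ` over the same pair would be a double edge of the contraction, which is a tree.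
  have hh : Function.Injective h := by
    intro t t' heq
    by_contra hne
    have hlt := (h t).2
    have hle := hC.2 (h t).1.1 (h t).1.2
    simp only [contract, if_neg hlt.ne] at hle
    have hsub : ({t.1.1, t'.1.1} : Finset (Fin (k + 2) × Fin (k + 2))) ⊆
        univ.filter fun s => i.predAbove s.1 = (h t).1.1 ∧ i.predAbove s.2 = (h t).1.2 := by
      intro s hs
      rcases mem_insert.1 hs with rfl | hs
      · simp [h]
      · rw [mem_singleton.1 hs, heq]
        simp [h]
    have := (sum_le_sum_of_subset (f := fun s => Γ.mult s.1 s.2) hsub).trans hle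
    rw [sum_pair fun h' => hne (Subtype.ext (Subtype.ext h'))] at this
    have h1 := t.2.1
    have h2 := t'.2.1
    omega
  have key := coeff_aeval_sum_X (R := ℂ) (f := (Subtype.val : E → VertexPair (k + 2)))
    (fun s : VertexPair (k + 1) => {t : VertexPair (k + 2) |
      i.predAbove t.1.1 = s.1.1 ∧ i.predAbove t.1.2 = s.1.2}) Subtype.val_injective hh
    (fun e s => by simp [h, Subtype.ext_iff, Prod.ext_iff]) P
    (Finsupp.equivFunOnFinite.symm 1)
  -- All multiplicities are `0` or `1`, so the truncated subtraction leaves the indicator of the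
  -- edges other than the new one.
  have hd : Γ.exponent - Finsupp.single (newPair i) 1 =
      (Finsupp.equivFunOnFinite.symm 1).mapDomain (Subtype.val : E → VertexPair (k + 2)) := by
    ext t
    rw [mapDomain_one_apply Subtype.val_injective, Finsupp.tsub_apply, exponent_apply,
      Finsupp.single_apply]
    have h1 := hΓ.2 t.1.1 t.1.2
    split_ifs with h2 h3 h3
    · obtain ⟨e, rfl⟩ := h3
      exact absurd h2.symm e.2.2
    · omega
    · obtain ⟨e, rfl⟩ := h3
      have := e.2.1
      omega
    · have : Γ.mult t.1.1 t.1.2 = 0 := by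
        by_contra h4
        exact h3 ⟨⟨t, h4, fun h5 => h2 h5.symm⟩, rfl⟩
      omega
  have hs : (Γ.contract i.predAbove).exponent =
      (Finsupp.equivFunOnFinite.symm 1).mapDomain h := by
    ext s
    rw [mapDomain_one_apply hh, exponent_apply]
    have h1 := hC.2 s.1.1 s.1.2
    have h2 := contract_mult_ne_zero_iff i.predAbove Γ s.2.ne
    have h3 : s ∈ Set.range h ↔ (Γ.contract i.predAbove).mult s.1.1 s.1.2 ≠ 0 := by
      rw [h2]
      constructor
      · rintro ⟨t, rfl⟩
        exact ⟨_, _, rfl, rfl, t.2.1⟩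
      · rintro ⟨p, q, hp, hq, hpq⟩
        have hlt : p < q := by
          by_contra hle
          have := Fin.predAbove_right_monotone i (not_lt.1 hle)
          rw [hp, hq] at this
          exact absurd s.2 this.not_gt
        refine ⟨⟨⟨(p, q), hlt⟩, hpq, ?_⟩, Subtype.ext (Prod.ext hp hq)⟩
        intro hnew
        have hp' : p = i.castSucc := congrArg (fun t : VertexPair (k + 2) => t.1.1) hnew
        have hq' : q = i.succ := congrArg (fun t : VertexPair (k + 2) => t.1.2) hnew
        have := s.2
        rw [← hp, ← hq, hp', hq'] at this
        simp at this
    split_ifs with h4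
    · have := h3.1 h4
      omega
    · exact not_not.1 fun h5 => h4 (h3.2 h5)
  rw [hd, hs]
  exact key

/-- The last step of the recursion multiplies by the variable of the new edge, so the term of `i`
contributes only if `i` and `i + 1` are joined in `Γ`; undoing the split contracts that edge. -/
theorem expansion_succ_apply {k n : ℕ} {Γ : OrderedGraph (k + 2) n} (hΓ : Γ.IsTree) :
    expansion (k + 1) n Γ = (1 / (2 * ((k : ℂ) + 1))) * ∑ i : Fin (k + 1),
      if Γ.mult i.castSucc i.succ ≠ 0 then expansion k n (Γ.contract i.predAbove) else 0 := by
  classical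
  rw [expansion_apply, expansionPoly, MvPolynomial.coeff_smul, MvPolynomial.coeff_sum]
  simp only [MvPolynomial.coeff_smul]
  rw [← smul_sum, smul_smul, smul_eq_mul]
  congr 1
  · field_simp
  · refine sum_congr rfl fun i _ => ?_
    rw [MvPolynomial.coeff_X_mul', expansion_apply]
    have hmem : newPair i ∈ Γ.exponent.support ↔ Γ.mult i.castSucc i.succ ≠ 0 := by
      simp [newPair]
    by_cases hi : Γ.mult i.castSucc i.succ ≠ 0
    · rw [if_pos (hmem.2 hi), if_pos hi, coeff_splitEdges hΓ hi]
      rfl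
    · rw [if_neg fun h => hi (hmem.1 h), if_neg hi]

/-! ### Numberings of a graph and of its contractions -/

theorem insertNth_castSucc_injective {k : ℕ} (τ : Equiv.Perm (Fin (k + 1))) (b : Fin (k + 2))
    (i : Fin (k + 1)) : Function.Injective
      (b.insertNth i.castSucc (i.castSucc.succAbove ∘ τ) : Fin (k + 2) → Fin (k + 2)) := by
  intro p q
  refine Fin.succAboveCases b ?_ (fun p' => ?_) p <;>
  refine Fin.succAboveCases b ?_ (fun q' => ?_) q <;>
  simp [Fin.ne_succAbove, Fin.succAbove_ne]

/-- The permutation that sends `b` to `i = τ a` and `b.succAbove a` to `i + 1`, and that induces `τ`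
on the vertices other than `b`. -/
def insertPerm {k : ℕ} (τ : Equiv.Perm (Fin (k + 1))) (b : Fin (k + 2)) (a : Fin (k + 1)) :
    Equiv.Perm (Fin (k + 2)) :=
  Equiv.ofBijective _ (Finite.injective_iff_bijective.1 (insertNth_castSucc_injective τ b (τ a)))

theorem insertPerm_self {k : ℕ} (τ : Equiv.Perm (Fin (k + 1))) (b : Fin (k + 2))
    (a : Fin (k + 1)) : insertPerm τ b a b = (τ a).castSucc := by
  simp [insertPerm]

theorem insertPerm_succAbove {k : ℕ} (τ : Equiv.Perm (Fin (k + 1))) (b : Fin (k + 2))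
    (a p : Fin (k + 1)) :
    insertPerm τ b a (b.succAbove p) = (τ a).castSucc.succAbove (τ p) := by
  simp [insertPerm]

theorem insertPerm_inv_castSucc {k : ℕ} (τ : Equiv.Perm (Fin (k + 1))) (b : Fin (k + 2))
    (a : Fin (k + 1)) : (insertPerm τ b a)⁻¹ (τ a).castSucc = b := by
  rw [Equiv.Perm.inv_eq_iff_eq, insertPerm_self]

theorem insertPerm_inv_succ {k : ℕ} (τ : Equiv.Perm (Fin (k + 1))) (b : Fin (k + 2))
    (a : Fin (k + 1)) : (insertPerm τ b a)⁻¹ (τ a).succ = b.succAbove a := by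
  rw [Equiv.Perm.inv_eq_iff_eq, insertPerm_succAbove, Fin.succAbove_castSucc_self]

/-- Numbering the vertices and merging the positions `i`, `i + 1` is the same as merging the two
vertices there and numbering the result by `τ`. Thus the contractions in the recursion become
renumberings of one contraction that does not depend on `τ`. -/
theorem predAbove_comp_insertPerm {k : ℕ} (τ : Equiv.Perm (Fin (k + 1))) (b : Fin (k + 2))
    (a : Fin (k + 1)) :
    (τ a).predAbove ∘ insertPerm τ b a = τ ∘ (b.insertNth a id : Fin (k + 2) → Fin (k + 1)) := by
  funext p
  refine Fin.succAboveCases b ?_ (fun p' => ?_) p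
  · simp [insertPerm_self]
  · simp [insertPerm_succAbove, Fin.predAbove_succAbove]

/-- From `σ` and `i` one recovers `b = σ⁻¹ i`, then `τ` from the values off `b`, then `a = τ⁻¹ i`.
Both sides have `(k + 2)! (k + 1)` elements, so injectivity suffices. -/
theorem insertPerm_bijective {k : ℕ} :
    Function.Bijective fun z : (Fin (k + 2) × Fin (k + 1)) × Equiv.Perm (Fin (k + 1)) =>
      (insertPerm z.2 z.1.1 z.1.2, z.2 z.1.2) := by
  rw [Fintype.bijective_iff_injective_and_card]
  constructor
  · rintro ⟨⟨b, a⟩, τ⟩ ⟨⟨b', a'⟩, τ'⟩ h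
    simp only [Prod.mk.injEq] at h
    obtain ⟨hσ, hi⟩ := h
    have hb : b = b' := by
      rw [← insertPerm_inv_castSucc τ b a, hσ, hi, insertPerm_inv_castSucc]
    subst hb
    have hτ : τ = τ' := by
      ext1 p
      have := DFunLike.congr_fun hσ (b.succAbove p)
      rw [insertPerm_succAbove, insertPerm_succAbove, hi] at this
      exact Fin.succAbove_right_injective this
    subst hτ
    rw [τ.injective hi]
  · simp only [Fintype.card_prod, Fintype.card_perm, Fintype.card_fin, Nat.factorial_succ]
    ring

theorem identifies_insertNth {k : ℕ} (b : Fin (k + 2)) (a : Fin (k + 1)) :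
    Identifies (b.insertNth a id : Fin (k + 2) → Fin (k + 1)) b (b.succAbove a) where
  surjective := fun p => ⟨b.succAbove p, by simp⟩
  ne := Fin.ne_succAbove b a
  eq_iff p q := by
    refine Fin.succAboveCases b ?_ (fun p' => ?_) p <;>
    refine Fin.succAboveCases b ?_ (fun q' => ?_) q <;>
    simp [Fin.ne_succAbove, eq_comm]

theorem sum_mult_succAbove {k n : ℕ} (Γ : OrderedGraph (k + 2) n) :
    ∑ z : Fin (k + 2) × Fin (k + 1), Γ.mult z.1 (z.1.succAbove z.2) =
      ∑ t : Fin (k + 2) × Fin (k + 2), Γ.mult t.1 t.2 := by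
  rw [Fintype.sum_prod_type, Fintype.sum_prod_type]
  refine sum_congr rfl fun b _ => ?_
  rw [Fin.sum_univ_succAbove _ b, Γ.loopless, zero_add]

/-- The weights of all numberings of a tree, counted with repetitions, add up to one. -/
theorem sum_expansion_smul {k n : ℕ} {Γ : OrderedGraph (k + 1) n} (hΓ : Γ.IsTree) :
    ∑ σ : Equiv.Perm (Fin (k + 1)), expansion k n (σ • Γ) = 1 := by
  induction k with
  | zero =>
    have : Unique (Equiv.Perm (Fin (0 + 1))) := inferInstanceAs (Unique (Equiv.Perm (Fin 1)))
    rw [Fintype.sum_unique, expansion_apply, expansionPoly, MvPolynomial.coeff_one, if_pos]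
    ext s
    have := s.2
    omega
  | succ k ih =>
    have h1 : ∀ σ : Equiv.Perm (Fin (k + 2)), expansion (k + 1) n (σ • Γ) =
        (1 / (2 * ((k : ℂ) + 1))) * ∑ i : Fin (k + 1),
          if Γ.mult (σ⁻¹ i.castSucc) (σ⁻¹ i.succ) ≠ 0 then
            expansion k n (Γ.contract (i.predAbove ∘ σ)) else 0 := by
      intro σ
      rw [expansion_succ_apply (hΓ.smul σ)]
      simp only [smul_mult, contract_smul]
    -- The pair `z` stands for the ordered pair of distinct vertices `z.1`, `z.1.succAbove z.2`. If
    -- they are adjacent, the induction hypothesis for the contracted tree gives `1`, which is also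
    -- their multiplicity.
    have h2 : ∀ z : Fin (k + 2) × Fin (k + 1), ∑ τ : Equiv.Perm (Fin (k + 1)),
        (if Γ.mult z.1 (z.1.succAbove z.2) ≠ 0 then
          expansion k n (τ • Γ.contract (z.1.insertNth z.2 id : Fin (k + 2) → Fin (k + 1)))
          else 0) = (Γ.mult z.1 (z.1.succAbove z.2) : ℂ) := by
      intro z
      split_ifs with h
      · rw [ih (hΓ.contract (identifies_insertNth _ _) h),
          le_antisymm (hΓ.2 _ _) (Nat.one_le_iff_ne_zero.2 h), Nat.cast_one]
      · rw [not_not.1 h, sum_const_zero, Nat.cast_zero]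
    simp only [h1, ← mul_sum]
    rw [← Fintype.sum_prod_type', ← Fintype.sum_bijective _ insertPerm_bijective (fun z =>
      if Γ.mult z.1.1 (z.1.1.succAbove z.1.2) ≠ 0 then expansion k n (z.2 • Γ.contract
        (z.1.1.insertNth z.1.2 id : Fin (k + 2) → Fin (k + 1))) else 0) _ ?_]
    · rw [Fintype.sum_prod_type]
      simp only [h2]
      -- The multiplicities over ordered pairs add up to `2(k + 1)`, which cancels the prefactor.
      rw [← Nat.cast_sum, sum_mult_succAbove, ((isTree_iff Γ).1 hΓ).2]
      have : (k : ℂ) + 1 ≠ 0 := Nat.cast_add_one_ne_zero k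
      push_cast
      field_simp
    · intro z
      simp only [insertPerm_inv_castSucc, insertPerm_inv_succ, predAbove_comp_insertPerm,
        contract_perm_comp]

/-! ### Orbit counting -/

theorem card_smul_eq {G X : Type*} [Group G] [Fintype G] [DecidableEq X] [MulAction G X] {x y : X}
    (hy : y ∈ MulAction.orbit G x) :
    #{g : G | g • x = y} = Nat.card (MulAction.stabilizer G x) := by
  obtain ⟨h, rfl⟩ := hy
  rw [← Fintype.card_subtype, ← Nat.card_eq_fintype_card]
  exact Nat.card_congr
    { toFun := fun g => ⟨h⁻¹ * g.1, by
        rw [MulAction.mem_stabilizer_iff, mul_smul, g.2, inv_smul_smul]⟩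
      invFun := fun g => ⟨h * g.1, by rw [mul_smul, MulAction.mem_stabilizer_iff.1 g.2]⟩
      left_inv := fun g => by simp
      right_inv := fun g => by simp }

/-- When `σ` runs over all permutations, `σ • Γ` takes each value in the orbit equally often, namely
as often as the stabilizer has elements. -/
theorem symmetryFactor_mul_weight {k n : ℕ} (c : OrderedGraph k n →₀ ℂ) (Γ : OrderedGraph k n) :
    (Γ.symmetryFactor : ℂ) * weight c Γ = ∑ σ : Equiv.Perm (Fin k), c (σ • Γ) := by
  classical
  have horbit : MulAction.orbit (Equiv.Perm (Fin k)) Γ =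
      ((univ.image fun σ : Equiv.Perm (Fin k) => σ • Γ : Finset _) : Set (OrderedGraph k n)) := by
    ext; simp [MulAction.mem_orbit_iff]
  rw [weight, horbit, finsum_mem_coe_finset, mul_sum,
    ← sum_fiberwise_of_maps_to (t := univ.image fun σ : Equiv.Perm (Fin k) => σ • Γ)
      (g := fun σ => σ • Γ) fun σ _ => mem_image_of_mem _ (mem_univ σ)]
  refine sum_congr rfl fun Γ' hΓ' => ?_
  have : Γ' ∈ MulAction.orbit (Equiv.Perm (Fin k)) Γ := by rw [horbit]; exact hΓ'
  rw [symmetryFactor, ← card_smul_eq this, ← nsmul_eq_mul, ← sum_const]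
  exact sum_congr rfl fun σ hσ => by rw [(mem_filter.1 hσ).2]

end TreeWeight

end

/-- Trees with `k + 1` vertices are considered. The scalars in the expansion of
`Λ^k(φ(x_1) ⋯ φ(x_n))` into ordered graphs exist and are unique, and with them every tree has the
weight `1 / s`, where `s` is its symmetry factor. -/
theorem mainTheorem2 (k n : ℕ) :
    (∃! c : TreeWeight.OrderedGraph (k + 1) n →₀ ℂ, TreeWeight.IsGraphExpansion.{u} k n c) ∧
      ∀ c : TreeWeight.OrderedGraph (k + 1) n →₀ ℂ, TreeWeight.IsGraphExpansion.{u} k n c →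
        ∀ γ : TreeWeight.OrderedGraph (k + 1) n, γ.IsTree →
          TreeWeight.weight c γ = 1 / (γ.symmetryFactor : ℂ) := by
  refine ⟨TreeWeight.existsUnique_isGraphExpansion k n, fun c hc γ hγ => ?_⟩
  obtain rfl := (TreeWeight.existsUnique_isGraphExpansion.{u} k n).unique hc
    (TreeWeight.isGraphExpansion_expansion k n)
  have hs : (γ.symmetryFactor : ℂ) ≠ 0 := Nat.cast_ne_zero.2 Nat.card_pos.ne'
  rw [eq_div_iff hs, mul_comm, TreeWeight.symmetryFactor_mul_weight,
    TreeWeight.sum_expansion_smul hγ]
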